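/- Let $\mathcal S,\mathcal A$ be finite and let $\mathcal M=(\mathcal S,\mathcal A,P,r,\gamma)$ be a Markov decision process with $\gamma\in(0,1)$ and $|r(s,a)|\le R_{\max}$ for all $(s,a)$ (in particular, $r(s,a)\in[0,R_{\max}]$ is allowed). The optimal action-value function $Q^*$ of $\mathcal M$ is the unique fixed point of the Bellman operator $(TQ)(s,a)=r(s,a)+\gamma\sum_{s'}P(s'\mid s,a)\max_{a'}Q(s',a')$. Fix a choice model with parameter $\theta\in\mathbb R^d$: a finite nonempty set $\mathcal J$ of booking choices with multinomial logit probabilities $P(j\mid s,a;\theta)=e^{\theta^\top\phi_j(s,a)}/\sum_k e^{\theta^\top\phi_k(s,a)}$; a finite set of orders $o$, each with a distribution $P(z\mid o;\theta)$ on a finite set of shock outcomes; finite sets $\mathcal N(s,a,j)$ of orders whose shocks are imputed; rewards $r^{\mathrm{imm}}(s,a,j)$ and $r^{\mathrm{shock}}(o,z)$; and a next-state map $f(s,a,j,\{z_o\})$. A synthetic sample at $(s,a)$ is obtained by drawing $j'\sim P(\cdot\mid s,a;\theta)$ and, independently, $z_o\sim P(\cdot\mid o;\theta)$ for all orders, and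 setting $r'=r^{\mathrm{imm}}(s,a,j')+\sum_{o\in\mathcal N(s,a,j')}r^{\mathrm{shock}}(o,z_o)$ and $s'=f(s,a,j',\{z_o\})$. The induced approximate MDP $\tilde{\mathcal M}_\theta$ has reward $\tilde r_\theta(s,a)=\mathbb E[r']$, transition kernel $\tilde P_\theta(\cdot\mid s,a)=\mathrm{Law}(s')$ and discount factor $\gamma$; let $\tilde Q^*$ be its optimal action-value function. Put $\varepsilon_r=\|\tilde r_\theta-r\|_\infty$ and $\varepsilon_P=\max_{s,a}\|\tilde P_\theta(\cdot\mid s,a)-P(\cdot\mid s,a)\|_1$. Let $Q_0$ be an arbitrary deterministic table, and run tabular Q-learning with samples from $\tilde{\mathcal M}_\theta$ on a probability space with filtration $(\mathcal F_t)_{t\ge0}$: at time $t$ the pair $(s_t,a_t)$ and the step size $\alpha_t\in[0,1]$ are $\mathcal F_t$-measurable; conditionally on $\mathcal F_t$ a synthetic sample $(r'_t,s'_{t+1})$ is drawn at $(s_t,a_t)$, the draw being $\mathcal F_{t+1}$-measurable; and $$Q_{t+1}(s_t,a_t)=(1-\alpha_t)Q_t(s_t,a_t)+\alpha_t\bigl[r'_t+\gamma\max_{a'}Q_t(s'_{t+1},a')\bigr],$$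 all other entries being unchanged. (The rule that generates $(s_t,a_t)$ from the history is arbitrary; $\varepsilon$-greedy exploration is one example.) Assume coverage: almost surely, for every $(s,a)$, the step sizes along the visits to $(s,a)$ satisfy $\sum_{t:(s_t,a_t)=(s,a)}\alpha_t=\infty$ and $\sum_{t:(s_t,a_t)=(s,a)}\alpha_t^2<\infty$. (For $\alpha_t=1/n_t(s_t,a_t)$, with $n_t$ the visit count up to and including time $t$, this says that every pair is visited infinitely often.) Then, almost surely, the sampling noise vanishes, $\lim_{t\to\infty}\|Q_t-\tilde Q^*\|_\infty=0$, the error tends to the bias of the partial model, $\lim_{t\to\infty}\|Q_t-Q^*\|_\infty=\|\tilde Q^*-Q^*\|_\infty$, and $$\limsup_{t\to\infty}\|Q_t-Q^*\|_\infty\;\le\;\frac{\varepsilon_r}{1-\gamma}+\frac{\gamma R_{\max}\,\varepsilon_P}{(1-\gamma)^2}.$$ -/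

import Mathlib

open MeasureTheory Filter Topology

noncomputable section

/-- A finite discounted Markov decision process: expected one-step reward `r(s,a)`,
transition kernel `P(s' | s,a)` and discount factor `γ ∈ (0,1)`. -/
structure MDP (S A : Type*) [Fintype S] where
  reward : S × A → ℝ
  trans : S × A → S → ℝ
  trans_mem : ∀ x, trans x ∈ stdSimplex ℝ S
  discount : ℝ
  discount_mem : discount ∈ Set.Ioo (0 : ℝ) 1

/-- `max_{a'} Q(s,a')`. -/
def maxQ {S A : Type*} [Fintype A] [Nonempty A] (Q : S × A → ℝ) (s : S) : ℝ :=
  Finset.univ.sup' Finset.univ_nonempty fun a => Q (s, a)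

theorem abs_maxQ_sub_le {S A : Type*} [Fintype S] [Fintype A] [Nonempty A]
    (Q Q' : S × A → ℝ) (s : S) : |maxQ Q s - maxQ Q' s| ≤ dist Q Q' := by
  have key : ∀ R R' : S × A → ℝ, maxQ R s - maxQ R' s ≤ dist R R' := by
    intro R R'
    rw [sub_le_iff_le_add]
    refine Finset.sup'_le _ _ fun a _ => ?_
    have h1 : R (s, a) - R' (s, a) ≤ dist R R' :=
      (le_abs_self _).trans (dist_le_pi_dist R R' (s, a))
    have h2 : R' (s, a) ≤ maxQ R' s :=
      Finset.le_sup' (fun a => R' (s, a)) (Finset.mem_univ a)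
    linarith
  rw [abs_le]
  have h1 := key Q Q'
  have h2 := key Q' Q
  rw [dist_comm] at h2
  constructor <;> linarith

namespace MDP

variable {S A : Type*} [Fintype S] [Fintype A] [Nonempty A]

/-- The Bellman optimality operator
`(TQ)(s,a) = r(s,a) + γ ∑_{s'} P(s' | s,a) max_{a'} Q(s',a')`. -/
def bellman (M : MDP S A) (Q : S × A → ℝ) : S × A → ℝ :=
  fun x => M.reward x + M.discount * ∑ s', M.trans x s' * maxQ Q s'

theorem contracting_bellman (M : MDP S A) :
    ContractingWith ⟨M.discount, M.discount_mem.1.le⟩ M.bellman := by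
  refine ⟨M.discount_mem.2, LipschitzWith.of_dist_le_mul fun Q Q' => ?_⟩
  have h0 : 0 ≤ M.discount := M.discount_mem.1.le
  refine (dist_pi_le_iff (mul_nonneg h0 dist_nonneg)).2 fun x => ?_
  have h1 : M.bellman Q x - M.bellman Q' x =
      M.discount * ∑ s', M.trans x s' * (maxQ Q s' - maxQ Q' s') := by
    simp only [bellman, mul_sub, Finset.sum_sub_distrib]
    ring
  have h2 : |∑ s', M.trans x s' * (maxQ Q s' - maxQ Q' s')| ≤ dist Q Q' := by
    calc |∑ s', M.trans x s' * (maxQ Q s' - maxQ Q' s')|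
        ≤ ∑ s', |M.trans x s' * (maxQ Q s' - maxQ Q' s')| := Finset.abs_sum_le_sum_abs _ _
      _ ≤ ∑ s', M.trans x s' * dist Q Q' := by
          refine Finset.sum_le_sum fun s' _ => ?_
          rw [abs_mul, abs_of_nonneg ((M.trans_mem x).1 s')]
          exact mul_le_mul_of_nonneg_left (abs_maxQ_sub_le Q Q' s') ((M.trans_mem x).1 s')
      _ = dist Q Q' := by rw [← Finset.sum_mul, (M.trans_mem x).2, one_mul]
  rw [Real.dist_eq, h1, abs_mul, abs_of_nonneg h0]
  exact mul_le_mul_of_nonneg_left h2 h0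

/-- The optimal action-value function: the unique fixed point of the Bellman optimality
operator. -/
def qStar (M : MDP S A) : S × A → ℝ :=
  M.contracting_bellman.fixedPoint M.bellman

end MDP

/-- A discrete choice model for customer behaviour on the reduced state space.
`J` is the set of booking choices (room types and the outside option), `O` the orders,
`Z` the possible shock outcomes of an order (keep, modify, cancel, ...), `d` the number of
parameters. -/
structure ChoiceModel (S A J O Z : Type*) [Fintype Z] (d : ℕ) where
  /-- The feature map `φ_j(s,a)`. -/
  feature : J → S × A → EuclideanSpace ℝ (Fin d)
  /-- The shock probabilities `P(z | o; θ)`. -/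
  shockProb : EuclideanSpace ℝ (Fin d) → O → Z → ℝ
  shockProb_mem : ∀ θ o, shockProb θ o ∈ stdSimplex ℝ Z
  /-- The orders whose shocks are imputed at `(s,a)` when the booking choice is `j`. -/
  orders : S × A → J → Finset O
  /-- The immediate reward `r^imm(s,a,j)`. -/
  immReward : S × A → J → ℝ
  /-- The shock reward `r^shock(o,z)`. -/
  shockReward : O → Z → ℝ
  /-- The next state `f(s,a,j,{z_o})`. -/
  nextState : S × A → J → (O → Z) → S

namespace ChoiceModel

variable {S A J O Z : Type*} [Fintype S] [DecidableEq S] [Fintype J] [Nonempty J]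
  [Fintype O] [DecidableEq O] [Fintype Z] {d : ℕ}

/-- The multinomial logit choice probabilities
`P(j | s,a; θ) = exp(θᵀφ_j(s,a)) / ∑_k exp(θᵀφ_k(s,a))`. -/
def choiceProb (C : ChoiceModel S A J O Z d) (θ : EuclideanSpace ℝ (Fin d))
    (x : S × A) (j : J) : ℝ :=
  Real.exp (inner ℝ θ (C.feature j x)) / ∑ k, Real.exp (inner ℝ θ (C.feature k x))

/-- The law of a synthetic draw at `(s,a)`: the booking choice `j'` is drawn from the logit
model and, independently, the shock outcome of every order from the shock model. -/
def drawProb (C : ChoiceModel S A J O Z d) (θ : EuclideanSpace ℝ (Fin d))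
    (x : S × A) (y : J × (O → Z)) : ℝ :=
  C.choiceProb θ x y.1 * ∏ o, C.shockProb θ o (y.2 o)

/-- The synthetic reward `r' = r^imm(s,a,j') + ∑_o r^shock(o,z_o)`. -/
def synthReward (C : ChoiceModel S A J O Z d) (x : S × A) (y : J × (O → Z)) : ℝ :=
  C.immReward x y.1 + ∑ o ∈ C.orders x y.1, C.shockReward o (y.2 o)

/-- The synthetic next state `s' = f(s,a,j',{z_o})`. -/
def synthNext (C : ChoiceModel S A J O Z d) (x : S × A) (y : J × (O → Z)) : S :=
  C.nextState x y.1 y.2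

theorem drawProb_nonneg (C : ChoiceModel S A J O Z d) (θ : EuclideanSpace ℝ (Fin d))
    (x : S × A) (y : J × (O → Z)) : 0 ≤ C.drawProb θ x y :=
  mul_nonneg (div_nonneg (Real.exp_pos _).le (Finset.sum_nonneg fun _ _ => (Real.exp_pos _).le))
    (Finset.prod_nonneg fun o _ => (C.shockProb_mem θ o).1 _)

theorem sum_drawProb (C : ChoiceModel S A J O Z d) (θ : EuclideanSpace ℝ (Fin d))
    (x : S × A) : ∑ y, C.drawProb θ x y = 1 := by
  have hz : ∑ z : O → Z, ∏ o, C.shockProb θ o (z o) = 1 := by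
    rw [← Fintype.prod_sum]
    exact Finset.prod_eq_one fun o _ => (C.shockProb_mem θ o).2
  have hj : ∑ j, C.choiceProb θ x j = 1 := by
    simp only [choiceProb]
    rw [← Finset.sum_div]
    exact div_self (Finset.sum_pos (fun _ _ => Real.exp_pos _) Finset.univ_nonempty).ne'
  rw [Fintype.sum_prod_type]
  simp only [drawProb]
  simp_rw [← Finset.mul_sum, hz, mul_one, hj]

/-- The approximate MDP induced by the choice model with fixed parameter `θ`: its reward is
the expected synthetic reward, its transition kernel the law of the synthetic next state. -/
def inducedMDP (C : ChoiceModel S A J O Z d) (θ : EuclideanSpace ℝ (Fin d))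
    (γ : ℝ) (hγ : γ ∈ Set.Ioo (0 : ℝ) 1) : MDP S A where
  reward x := ∑ y, C.drawProb θ x y * C.synthReward x y
  trans x s' := ∑ y, if C.synthNext x y = s' then C.drawProb θ x y else 0
  trans_mem x := by
    refine ⟨fun s' => Finset.sum_nonneg fun y _ => ?_, ?_⟩
    · split_ifs
      · exact C.drawProb_nonneg θ x y
      · exact le_rfl
    · rw [Finset.sum_comm]
      simp [C.sum_drawProb θ x]
  discount := γ
  discount_mem := hγ

/-- Tabular Q-learning with model-imputed sampling. At time `t` the pair `(s_t,a_t)` and the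
step size `α_t` are determined by the history `ℱ_t`; given `ℱ_t`, a synthetic draw `y_t` is made
from the choice model at `(s_t,a_t)`; it is known at time `t+1` and gives the synthetic reward
and next state with which the entry `(s_t,a_t)` of the table is updated. How `s_{t+1}` and
`a_{t+1}` arise from the history is left open: the trajectory may be that of the true
environment, or that of the model, under any (for example an ε-greedy) policy. -/
structure IsImputedQLearning [Fintype A] [Nonempty A] [DecidableEq A]
    {Ω : Type*} {mΩ : MeasurableSpace Ω} (C : ChoiceModel S A J O Z d)
    (θ : EuclideanSpace ℝ (Fin d)) (γ : ℝ) (μ : Measure Ω) (ℱ : Filtration ℕ mΩ)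
    (state : ℕ → Ω → S) (action : ℕ → Ω → A) (draw : ℕ → Ω → J × (O → Z))
    (α : ℕ → Ω → ℝ) (q₀ : S × A → ℝ) (Q : ℕ → Ω → S × A → ℝ) : Prop where
  state_meas : ∀ t s, MeasurableSet[ℱ t] {ω | state t ω = s}
  action_meas : ∀ t a, MeasurableSet[ℱ t] {ω | action t ω = a}
  draw_meas : ∀ t y, MeasurableSet[ℱ (t + 1)] {ω | draw t ω = y}
  step_meas : ∀ t, Measurable[ℱ t] (α t)
  step_mem : ∀ t ω, α t ω ∈ Set.Icc (0 : ℝ) 1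
  draw_law : ∀ t y,
    μ[{ω | draw t ω = y}.indicator (fun _ => (1 : ℝ)) | ℱ t] =ᵐ[μ]
      fun ω => C.drawProb θ (state t ω, action t ω) y
  table_zero : ∀ ω, Q 0 ω = q₀
  table_succ : ∀ t ω x, Q (t + 1) ω x =
    if x = (state t ω, action t ω) then
      (1 - α t ω) * Q t ω x +
        α t ω * (C.synthReward x (draw t ω) + γ * maxQ (Q t ω) (C.synthNext x (draw t ω)))
    else Q t ω x

end ChoiceModel

/-- Coverage: almost surely, along the visits to every state-action pair, the step sizes satisfy
the Robbins-Monro conditions `∑ α = ∞` and `∑ α² < ∞`. In particular every pair is visited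
infinitely often; conversely, if every pair is visited infinitely often, then the step sizes
`α_t = 1 / n_t(s_t,a_t)`, with `n_t` the number of visits up to and including time `t`, have this
property. -/
def RobbinsMonroCoverage {S A Ω : Type*} [DecidableEq S] [DecidableEq A]
    {mΩ : MeasurableSpace Ω} (μ : Measure Ω) (state : ℕ → Ω → S) (action : ℕ → Ω → A)
    (α : ℕ → Ω → ℝ) : Prop :=
  ∀ᵐ ω ∂μ, ∀ x : S × A,
    Tendsto (fun n => ∑ t ∈ Finset.range n, if (state t ω, action t ω) = x then α t ω else 0)
      atTop atTop ∧
    Summable fun t => if (state t ω, action t ω) = x then α t ω ^ 2 else 0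

end

/-! At a visited pair the update moves `Q t` towards a sampled target whose conditional mean is the
Bellman operator of the induced MDP (`bellman_inducedMDP`). Q-learning is thus asynchronous
stochastic approximation of the fixed point of a sup-norm contraction.

Probability enters only through the noise. Its series, weighted by the step sizes at one pair, is a
finite sum of martingale transforms with square-summable coefficients, so it converges almost surely
(`ae_tendsto_martingaleTransform`). The rest is pathwise: averaged noise dies out
(`tendsto_zero_of_recursive_average`), and what remains contracts the error bound by nearly `γ`
again and again (`tendsto_norm_sub_of_async_contraction`).

Hence the distance to `M.qStar` tends to the distance of the two fixed points, which the simulation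
lemma `MDP.norm_qStar_sub_qStar_le` bounds. -/

/-! ### Deterministic recursive averages -/

/-- A recursive average of inputs eventually bounded by `G`, with weights of infinite total mass,
is eventually bounded by anything larger than `G`. -/
theorem eventually_abs_le_of_recursive_average {y a g : ℕ → ℝ} {G ε : ℝ}
    (ha : ∀ t, a t ∈ Set.Icc (0 : ℝ) 1)
    (hsum : Tendsto (fun n => ∑ t ∈ Finset.range n, a t) atTop atTop)
    (hy : ∀ t, y (t + 1) = (1 - a t) * y t + a t * g t)
    (hg : ∀ᶠ t in atTop, |g t| ≤ G) (hε : 0 < ε) : ∀ᶠ t in atTop, |y t| ≤ G + ε := by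
  obtain ⟨N, hN⟩ := eventually_atTop.1 hg
  set s : ℕ → ℝ := fun n => ∑ t ∈ Finset.range n, a t with hs
  -- The excess of `|y|` over `G` is multiplied by at most `1 - a n ≤ exp (-a n)` at each step. The
  -- second inequality may be applied to the bound only if the bound is nonnegative, hence the
  -- positive part.
  set c : ℝ := max (|y N| - G) 0
  have hc : 0 ≤ c := le_max_right _ _
  have hbound : ∀ n ≥ N, |y n| - G ≤ Real.exp (s N - s n) * c := by
    intro n hn
    induction n, hn using Nat.le_induction with
    | base =>
      rw [sub_self, Real.exp_zero, one_mul]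
      exact le_max_left _ _
    | succ n hn ih =>
      have h0 := (ha n).1
      have h1 : 0 ≤ 1 - a n := sub_nonneg.2 (ha n).2
      have hstep : |y (n + 1)| ≤ (1 - a n) * |y n| + a n * G := by
        rw [hy]
        refine (abs_add_le _ _).trans ?_
        rw [abs_mul, abs_mul, abs_of_nonneg h0, abs_of_nonneg h1]
        gcongr
        exact hN n hn
      have hexp : Real.exp (s N - s (n + 1)) = Real.exp (-a n) * Real.exp (s N - s n) := by
        rw [← Real.exp_add, hs]
        simp only [Finset.sum_range_succ]
        ring_nf
      calc |y (n + 1)| - G ≤ (1 - a n) * (|y n| - G) := by linarith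
        _ ≤ (1 - a n) * (Real.exp (s N - s n) * c) := by gcongr
        _ ≤ Real.exp (-a n) * (Real.exp (s N - s n) * c) := by
          gcongr
          exact Real.one_sub_le_exp_neg _
        _ = Real.exp (s N - s (n + 1)) * c := by rw [hexp]; ring
  have hlim : Tendsto (fun n => Real.exp (s N - s n) * c) atTop (𝓝 0) := by
    have h1 : Tendsto (fun n => s N - s n) atTop atBot := by
      simpa [sub_eq_add_neg] using
        tendsto_atBot_add_const_left atTop (s N) (tendsto_neg_atTop_atBot.comp hsum)
    simpa using (Real.tendsto_exp_atBot.comp h1).mul_const c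
  filter_upwards [eventually_ge_atTop N, hlim.eventually_lt_const hε] with n hn h1
  linarith [hbound n hn]

/-- A recursive average of increments whose weighted series converges tends to zero. -/
theorem tendsto_zero_of_recursive_average {y a w : ℕ → ℝ} {l : ℝ}
    (ha : ∀ t, a t ∈ Set.Icc (0 : ℝ) 1)
    (hsum : Tendsto (fun n => ∑ t ∈ Finset.range n, a t) atTop atTop)
    (hy : ∀ t, y (t + 1) = (1 - a t) * y t + a t * w t)
    (hw : Tendsto (fun n => ∑ t ∈ Finset.range n, a t * w t) atTop (𝓝 l)) :
    Tendsto y atTop (𝓝 0) := by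
  set s : ℕ → ℝ := fun n => ∑ t ∈ Finset.range n, a t * w t with hs
  have hs0 : Tendsto (fun n => s n - l) atTop (𝓝 0) := by
    simpa using hw.sub_const l
  -- Summation by parts in disguise: after subtracting the centred partial sums, the inputs are `-(s
  -- t - l)`, which tend to zero, instead of the increments `w t`, which need not.
  have hu : ∀ t, y (t + 1) - (s (t + 1) - l) =
      (1 - a t) * (y t - (s t - l)) + a t * (-(s t - l)) := by
    intro t
    simp only [hy, hs, Finset.sum_range_succ]
    ring
  have hu0 : Tendsto (fun t => y t - (s t - l)) atTop (𝓝 0) := by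
    rw [Metric.tendsto_nhds]
    intro ε hε
    have hg : ∀ᶠ t in atTop, |-(s t - l)| ≤ ε / 4 := by
      have h := Metric.tendsto_nhds.1 hs0 (ε / 4) (by positivity)
      filter_upwards [h] with t ht
      rw [abs_neg]
      simpa [Real.dist_eq] using ht.le
    filter_upwards [eventually_abs_le_of_recursive_average
      (y := fun t => y t - (s t - l)) ha hsum hu hg
      (show 0 < ε / 4 by positivity)] with t ht
    rw [Real.dist_eq, sub_zero]
    linarith
  simpa using hu0.add hs0

/-! ### Almost sure convergence of martingale transforms -/

section MartingaleTransform

variable {Ω : Type*} {mΩ : MeasurableSpace Ω} {μ : Measure Ω} [IsProbabilityMeasure μ]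
  {ℱ : Filtration ℕ mΩ} {D H : ℕ → Ω → ℝ}

/-- Orthogonality of martingale increments to the past; it removes the cross term in the second
moment below. -/
theorem integral_mul_eq_zero_of_condExp_eq_zero {m : MeasurableSpace Ω} (hm : m ≤ mΩ)
    {f g : Ω → ℝ} {c : ℝ} (hf : Measurable[m] f) (hfc : ∀ ω, |f ω| ≤ c) (hg : Integrable g μ)
    (hg0 : μ[g | m] =ᵐ[μ] 0) : ∫ ω, f ω * g ω ∂μ = 0 := by
  have h1 := condExp_stronglyMeasurable_mul_of_bound hm hf.stronglyMeasurable hg c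
    (ae_of_all μ hfc)
  calc ∫ ω, f ω * g ω ∂μ = ∫ ω, (μ[f * g | m]) ω ∂μ := (integral_condExp hm).symm
    _ = ∫ _, (0 : ℝ) ∂μ := by
      refine integral_congr_ae ?_
      filter_upwards [h1, hg0] with ω h1 h2
      simp [h1, h2]
    _ = 0 := by simp

/-- A martingale transform with bounded total quadratic variation converges. -/
theorem ae_tendsto_martingaleTransform_of_sum_sq_le
    (hDm : ∀ t, Measurable[ℱ (t + 1)] (D t)) (hDb : ∀ t ω, |D t ω| ≤ 1)
    (hD0 : ∀ t, μ[D t | ℱ t] =ᵐ[μ] 0) (hHm : ∀ t, Measurable[ℱ t] (H t)) {K : ℝ}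
    (hK : ∀ n ω, ∑ t ∈ Finset.range n, H t ω ^ 2 ≤ K) :
    ∀ᵐ ω ∂μ, ∃ l, Tendsto (fun n => ∑ t ∈ Finset.range n, H t ω * D t ω) atTop (𝓝 l) := by
  have hHb : ∀ t ω, |H t ω| ≤ 1 + K := by
    intro t ω
    have h1 : H t ω ^ 2 ≤ K := (Finset.single_le_sum (f := fun t => H t ω ^ 2)
      (fun _ _ => sq_nonneg _) (Finset.self_mem_range_succ t)).trans (hK (t + 1) ω)
    nlinarith [sq_abs (H t ω), sq_nonneg (|H t ω| - 1), abs_nonneg (H t ω)]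
  set X : ℕ → Ω → ℝ := fun n ω => ∑ t ∈ Finset.range n, H t ω * D t ω with hX
  have hXm : ∀ n, Measurable[ℱ n] (X n) := by
    intro n
    refine Finset.measurable_sum _ fun t ht => ?_
    have htn : t + 1 ≤ n := Finset.mem_range.1 ht
    exact ((hHm t).mono (ℱ.mono (by omega)) le_rfl).mul ((hDm t).mono (ℱ.mono htn) le_rfl)
  have hXb : ∀ n ω, |X n ω| ≤ n * (1 + K) := by
    intro n ω
    refine (Finset.abs_sum_le_sum_abs _ _).trans ?_
    calc ∑ t ∈ Finset.range n, |H t ω * D t ω| ≤ ∑ t ∈ Finset.range n, (1 + K) := by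
          refine Finset.sum_le_sum fun t _ => ?_
          rw [abs_mul]
          have := mul_le_mul (hHb t ω) (hDb t ω) (abs_nonneg _) ((abs_nonneg _).trans (hHb t ω))
          linarith
      _ = n * (1 + K) := by rw [Finset.sum_const, Finset.card_range, nsmul_eq_mul]
  have hint : ∀ {f : Ω → ℝ} (c : ℝ), Measurable f → (∀ ω, |f ω| ≤ c) → Integrable f μ :=
    fun c hf hc => Integrable.of_bound hf.aestronglyMeasurable c (ae_of_all _ hc)
  have hX' : ∀ n, Measurable (X n) := fun n => (hXm n).mono (ℱ.le n) le_rfl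
  have hD' : ∀ n, Measurable (D n) := fun n => (hDm n).mono (ℱ.le _) le_rfl
  have hH' : ∀ n, Measurable (H n) := fun n => (hHm n).mono (ℱ.le _) le_rfl
  have hXi : ∀ n, Integrable (X n) μ := fun n => hint _ (hX' n) (hXb n)
  have hDi : ∀ n, Integrable (D n) μ := fun n => hint _ (hD' n) (hDb n)
  have hmart : Martingale X ℱ μ := by
    refine martingale_of_condExp_sub_eq_zero_nat (fun n => (hXm n).stronglyMeasurable) hXi ?_
    intro n
    have h1 : X (n + 1) - X n = H n * D n := by
      ext ω
      simp [hX, Finset.sum_range_succ]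
    rw [h1]
    filter_upwards [condExp_stronglyMeasurable_mul_of_bound (ℱ.le n) (hHm n).stronglyMeasurable
      (hDi n) _ (ae_of_all μ (hHb n)), hD0 n] with ω h2 h3
    simp [h2, h3]
  have hH2i : ∀ n, Integrable (fun ω => H n ω ^ 2) μ := by
    intro n
    refine hint ((1 + K) ^ 2) ((hH' n).pow_const 2) fun ω => ?_
    rw [abs_pow]
    exact pow_le_pow_left₀ (abs_nonneg _) (hHb n ω) 2
  have hX2i : ∀ n, Integrable (fun ω => X n ω ^ 2) μ := by
    intro n
    refine hint ((n * (1 + K)) ^ 2) ((hX' n).pow_const 2) fun ω => ?_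
    rw [abs_pow]
    exact pow_le_pow_left₀ (abs_nonneg _) (hXb n ω) 2
  have hcross : ∀ n ω, |2 * X n ω * H n ω| ≤ 2 * (n * (1 + K)) * (1 + K) := by
    intro n ω
    rw [abs_mul, abs_mul, abs_of_pos (two_pos : (0 : ℝ) < 2)]
    have := mul_le_mul (hXb n ω) (hHb n ω) (abs_nonneg _) ((abs_nonneg _).trans (hXb n ω))
    nlinarith
  -- Increments are orthogonal and `D n ^ 2 ≤ 1`, so second moments grow by at most that of `H n`.
  have hsq : ∀ n, ∫ ω, X n ω ^ 2 ∂μ ≤ ∫ ω, ∑ t ∈ Finset.range n, H t ω ^ 2 ∂μ := by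
    intro n
    induction n with
    | zero => simp [hX]
    | succ n ih =>
      have hzero : ∫ ω, 2 * X n ω * H n ω * D n ω ∂μ = 0 :=
        integral_mul_eq_zero_of_condExp_eq_zero (ℱ.le n) (((hXm n).const_mul 2).mul (hHm n))
          (hcross n) (hDi n) (hD0 n)
      have hci : Integrable (fun ω => 2 * X n ω * H n ω * D n ω) μ := by
        refine hint (2 * (n * (1 + K)) * (1 + K) * 1) ((((hX' n).const_mul 2).mul (hH' n)).mul (hD' n)) fun ω => ?_
        rw [abs_mul]
        exact mul_le_mul (hcross n ω) (hDb n ω) (abs_nonneg _)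
          ((abs_nonneg _).trans (hcross n ω))
      have hsi : Integrable (fun ω => ∑ t ∈ Finset.range n, H t ω ^ 2) μ :=
        integrable_finsetSum _ fun t _ => hH2i t
      calc ∫ ω, X (n + 1) ω ^ 2 ∂μ
          ≤ ∫ ω, (X n ω ^ 2 + 2 * X n ω * H n ω * D n ω) + H n ω ^ 2 ∂μ := by
            refine integral_mono (hX2i _) (((hX2i n).add hci).add (hH2i n)) fun ω => ?_
            have h1 : X (n + 1) ω = X n ω + H n ω * D n ω := by
              simp [hX, Finset.sum_range_succ]
            have h2 : D n ω ^ 2 ≤ 1 := (sq_le_one_iff_abs_le_one _).2 (hDb n ω)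
            simp only [h1]
            nlinarith [sq_nonneg (H n ω)]
        _ = ∫ ω, X n ω ^ 2 ∂μ + ∫ ω, H n ω ^ 2 ∂μ := by
            rw [integral_add (f := fun ω => X n ω ^ 2 + 2 * X n ω * H n ω * D n ω)
              ((hX2i n).add hci) (hH2i n), integral_add (hX2i n) hci, hzero, add_zero]
        _ ≤ ∫ ω, ∑ t ∈ Finset.range n, H t ω ^ 2 ∂μ + ∫ ω, H n ω ^ 2 ∂μ := by gcongr
        _ = ∫ ω, ∑ t ∈ Finset.range (n + 1), H t ω ^ 2 ∂μ := by
            rw [← integral_add hsi (hH2i n)]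
            simp only [Finset.sum_range_succ]
  -- Since `|x| ≤ 1 + x ^ 2`, the second-moment bound makes `X` bounded in L¹, as Doob's convergence
  -- theorem requires.
  have hL1 : ∀ n, eLpNorm (X n) 1 μ ≤ ((1 + K).toNNReal : ENNReal) := by
    intro n
    rw [eLpNorm_one_eq_lintegral_enorm, ← ofReal_integral_norm_eq_lintegral_enorm (hXi n)]
    refine ENNReal.ofReal_le_ofReal ?_
    calc ∫ ω, ‖X n ω‖ ∂μ ≤ ∫ ω, 1 + X n ω ^ 2 ∂μ := by
          refine integral_mono (hXi n).norm ((integrable_const _).add (hX2i n)) fun ω => ?_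
          simp only [Real.norm_eq_abs]
          nlinarith [sq_abs (X n ω), sq_nonneg (|X n ω| - 1), abs_nonneg (X n ω)]
      _ = 1 + ∫ ω, X n ω ^ 2 ∂μ := by
          rw [integral_add (integrable_const _) (hX2i n)]
          simp
      _ ≤ 1 + ∫ _, K ∂μ := by
          have h := (hsq n).trans (integral_mono (integrable_finsetSum _ fun t _ => hH2i t)
            (integrable_const _) (hK n))
          linarith
      _ = 1 + K := by simp
  exact hmart.submartingale.exists_ae_tendsto_of_bdd hL1

/-- A martingale transform converges almost surely if its total quadratic variation is almost
surely finite. -/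
theorem ae_tendsto_martingaleTransform
    (hDm : ∀ t, Measurable[ℱ (t + 1)] (D t)) (hDb : ∀ t ω, |D t ω| ≤ 1)
    (hD0 : ∀ t, μ[D t | ℱ t] =ᵐ[μ] 0) (hHm : ∀ t, Measurable[ℱ t] (H t))
    (hH : ∀ᵐ ω ∂μ, Summable fun t => H t ω ^ 2) :
    ∀ᵐ ω ∂μ, ∃ l, Tendsto (fun n => ∑ t ∈ Finset.range n, H t ω * D t ω) atTop (𝓝 l) := by
  set V : ℕ → Ω → ℝ := fun t ω => ∑ i ∈ Finset.range (t + 1), H i ω ^ 2 with hV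
  have hVm : ∀ t, Measurable[ℱ t] (V t) := by
    intro t
    refine Finset.measurable_sum _ fun i hi => ?_
    exact ((hHm i).mono (ℱ.mono (Nat.lt_succ_iff.1 (Finset.mem_range.1 hi))) le_rfl).pow_const 2
  -- Localization: the coefficients are switched off once the sum of squares exceeds `k`. `V t`
  -- includes the term at time `t`, which is still `ℱ t`-measurable, so `T k` stays predictable and
  -- its squares never sum to more than `k`.
  set T : ℕ → ℕ → Ω → ℝ := fun k t => {ω | V t ω ≤ k}.indicator (H t) with hT
  have hTsum : ∀ (k n : ℕ) (ω : Ω), ∑ t ∈ Finset.range n, T k t ω ^ 2 ≤ (k : ℝ) := by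
    intro k n ω
    induction n with
    | zero => simp
    | succ n ih =>
      by_cases h : V n ω ≤ k
      · refine le_trans (Finset.sum_le_sum fun t _ => ?_) h
        by_cases ht : ω ∈ {ω | V t ω ≤ k}
        · simp [hT, Set.indicator_of_mem ht]
        · have h0 : T k t ω = 0 := Set.indicator_of_notMem ht _
          rw [h0, zero_pow two_ne_zero]
          exact sq_nonneg _
      · have h0 : T k n ω = 0 := Set.indicator_of_notMem (by simpa using h) _
        rw [Finset.sum_range_succ, h0]
        simpa using ih
  have hconv : ∀ k : ℕ, ∀ᵐ ω ∂μ, ∃ l,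
      Tendsto (fun n => ∑ t ∈ Finset.range n, T k t ω * D t ω) atTop (𝓝 l) := fun k =>
    ae_tendsto_martingaleTransform_of_sum_sq_le hDm hDb hD0
      (fun t => (hHm t).indicator (measurableSet_le (hVm t) measurable_const)) (hTsum k)
  filter_upwards [ae_all_iff.2 hconv, hH] with ω h1 h2
  -- For `k` above the total sum of squares, the truncation never acts on this path.
  obtain ⟨k, hk⟩ := exists_nat_ge (∑' t, H t ω ^ 2)
  obtain ⟨l, hl⟩ := h1 k
  refine ⟨l, hl.congr fun n => Finset.sum_congr rfl fun t _ => ?_⟩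
  have hmem : ω ∈ {ω | V t ω ≤ k} :=
    (h2.sum_le_tsum _ fun _ _ => sq_nonneg _).trans hk
  simp only [hT, Set.indicator_of_mem hmem]

end MartingaleTransform

/-! ### Asynchronous contraction with noise -/

/-- Asynchronous stochastic approximation of the fixed point `q` of a pseudo-contraction converges
as soon as the weighted noise series converge. -/
theorem tendsto_norm_sub_of_async_contraction {ι : Type*} [Fintype ι] {T : (ι → ℝ) → ι → ℝ}
    {q : ι → ℝ} {γ B : ℝ} (hγ0 : 0 ≤ γ) (hγ1 : γ < 1)
    (hT : ∀ Q i, |T Q i - q i| ≤ γ * ‖Q - q‖)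
    {Q a w : ℕ → ι → ℝ} (ha : ∀ t i, a t i ∈ Set.Icc (0 : ℝ) 1)
    (hsum : ∀ i, Tendsto (fun n => ∑ t ∈ Finset.range n, a t i) atTop atTop)
    (hw : ∀ i, ∃ l, Tendsto (fun n => ∑ t ∈ Finset.range n, a t i * w t i) atTop (𝓝 l))
    (hQ : ∀ t i, Q (t + 1) i = (1 - a t i) * Q t i + a t i * (T (Q t) i + w t i))
    (hB : ∀ t, ‖Q t‖ ≤ B) : Tendsto (fun t => ‖Q t - q‖) atTop (𝓝 0) := by
  -- `W` is the noise passed through the same averaging from a zero start. It vanishes in the limit,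
  -- and `Q - q - W` is a recursive average of the noise-free inputs `T (Q t) - q`.
  set W : ℕ → ι → ℝ := fun t =>
    Nat.rec 0 (fun t W i => (1 - a t i) * W i + a t i * w t i) t with hW
  have hWs : ∀ t i, W (t + 1) i = (1 - a t i) * W t i + a t i * w t i := fun t i => rfl
  have hW0 : ∀ i, Tendsto (fun t => W t i) atTop (𝓝 0) := fun i =>
    let ⟨_, hl⟩ := hw i
    tendsto_zero_of_recursive_average (fun t => ha t i) (hsum i) (fun t => hWs t i) hl
  have hstep : ∀ {D ε : ℝ}, 0 < ε → (∀ᶠ t in atTop, ‖Q t - q‖ ≤ D) →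
      ∀ᶠ t in atTop, ‖Q t - q‖ ≤ γ * D + ε := by
    intro D ε hε hD
    have hY : ∀ i, ∀ᶠ t in atTop, |Q t i - q i - W t i| ≤ γ * D + ε / 2 := by
      intro i
      refine eventually_abs_le_of_recursive_average (y := fun t => Q t i - q i - W t i)
        (g := fun t => T (Q t) i - q i) (fun t => ha t i) (hsum i) (fun t => ?_) ?_ (half_pos hε)
      · simp only [hQ, hWs]
        ring
      · filter_upwards [hD] with t ht
        exact (hT _ _).trans (mul_le_mul_of_nonneg_left ht hγ0)
    have hWε : ∀ i, ∀ᶠ t in atTop, |W t i| ≤ ε / 2 := fun i => by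
      filter_upwards [Metric.tendsto_nhds.1 (hW0 i) _ (half_pos hε)] with t ht
      simpa [Real.dist_eq] using ht.le
    filter_upwards [eventually_all.2 hY, eventually_all.2 hWε, hD] with t h1 h2 h3
    refine (pi_norm_le_iff_of_nonneg ?_).2 fun i => ?_
    · have := (norm_nonneg _).trans h3
      positivity
    · rw [Real.norm_eq_abs, Pi.sub_apply]
      have h4 := abs_add_le (Q t i - q i - W t i) (W t i)
      rw [sub_add_cancel] at h4
      linarith [h1 i, h2 i]
  -- A rate strictly between `γ` and `1`: the slack `(1 - γ) / 2 * D` turns `γ * D + ε` into exactly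
  -- `ρ * D`. The `+ 1` in `E` keeps this slack positive.
  set ρ : ℝ := (1 + γ) / 2 with hρ
  have hρ1 : ρ < 1 := by rw [hρ]; linarith
  have hρ0 : 0 < ρ := by rw [hρ]; linarith
  set E : ℝ := B + ‖q‖ + 1 with hE
  have hE0 : 0 < E := by
    have := (norm_nonneg _).trans (hB 0)
    positivity
  have hgeom : ∀ k : ℕ, ∀ᶠ t in atTop, ‖Q t - q‖ ≤ ρ ^ k * E := by
    intro k
    induction k with
    | zero =>
      refine Eventually.of_forall fun t => (norm_sub_le _ _).trans ?_
      have := hB t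
      rw [pow_zero, one_mul]
      linarith
    | succ k ih =>
      have hε : 0 < (1 - γ) / 2 * (ρ ^ k * E) :=
        mul_pos (by linarith) (mul_pos (pow_pos hρ0 k) hE0)
      filter_upwards [hstep hε ih] with t ht
      refine ht.trans_eq ?_
      rw [pow_succ, hρ]
      ring
  rw [Metric.tendsto_nhds]
  intro ε hε
  have hlim : Tendsto (fun k : ℕ => ρ ^ k * E) atTop (𝓝 0) := by
    simpa using (tendsto_pow_atTop_nhds_zero_of_lt_one hρ0.le hρ1).mul_const E
  obtain ⟨k, hk⟩ := (hlim.eventually_lt_const hε).exists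
  filter_upwards [hgeom k] with t ht
  rw [Real.dist_eq, sub_zero, abs_norm]
  exact ht.trans_lt hk

/-! ### Bounds on optimal action-value functions -/

section MDPBounds

variable {S A : Type*} [Fintype S] [Fintype A] [Nonempty A]

theorem abs_maxQ_le (Q : S × A → ℝ) (s : S) : |maxQ Q s| ≤ ‖Q‖ := by
  have h := abs_maxQ_sub_le Q 0 s
  have h0 : maxQ (0 : S × A → ℝ) s = 0 := Finset.sup'_const _ _
  rwa [h0, sub_zero, dist_zero_right] at h

theorem MDP.bellman_qStar (M : MDP S A) : M.bellman M.qStar = M.qStar :=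
  M.contracting_bellman.fixedPoint_isFixedPt

theorem MDP.abs_bellman_sub_qStar_le (M : MDP S A) (Q : S × A → ℝ) (x : S × A) :
    |M.bellman Q x - M.qStar x| ≤ M.discount * ‖Q - M.qStar‖ := by
  have h := M.contracting_bellman.toLipschitzWith.dist_le_mul Q M.qStar
  rw [M.bellman_qStar, dist_eq_norm, dist_eq_norm] at h
  exact (norm_le_pi_norm (M.bellman Q - M.qStar) x).trans h

/-- The fixed-point equation gives `‖q‖ ≤ R + γ * ‖q‖`. `hR0` is not implied by `hR` when `S` is
empty. -/
theorem MDP.norm_qStar_le (M : MDP S A) {R : ℝ} (hR0 : 0 ≤ R) (hR : ∀ x, |M.reward x| ≤ R) :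
    ‖M.qStar‖ ≤ R / (1 - M.discount) := by
  have hγ0 := M.discount_mem.1
  have hγ1 : 0 < 1 - M.discount := sub_pos.2 M.discount_mem.2
  have h : ‖M.qStar‖ ≤ R + M.discount * ‖M.qStar‖ := by
    refine (pi_norm_le_iff_of_nonneg (by positivity)).2 fun x => ?_
    rw [Real.norm_eq_abs, ← congrFun M.bellman_qStar x]
    refine (abs_add_le _ _).trans (add_le_add (hR x) ?_)
    rw [abs_mul, abs_of_pos hγ0]
    refine mul_le_mul_of_nonneg_left ?_ hγ0.le
    calc |∑ s', M.trans x s' * maxQ M.qStar s'|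
        ≤ ∑ s', |M.trans x s' * maxQ M.qStar s'| := Finset.abs_sum_le_sum_abs _ _
      _ ≤ ∑ s', M.trans x s' * ‖M.qStar‖ := by
          refine Finset.sum_le_sum fun s' _ => ?_
          rw [abs_mul, abs_of_nonneg ((M.trans_mem x).1 s')]
          exact mul_le_mul_of_nonneg_left (abs_maxQ_le _ _) ((M.trans_mem x).1 s')
      _ = ‖M.qStar‖ := by rw [← Finset.sum_mul, (M.trans_mem x).2, one_mul]
  rw [le_div_iff₀ hγ1]
  linarith

/-- Simulation lemma: the optimal action-value functions of two MDPs with the same discount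
factor differ by at most the propagated reward and transition errors. -/
theorem MDP.norm_qStar_sub_qStar_le (M N : MDP S A) (hd : N.discount = M.discount) {R : ℝ}
    (hR0 : 0 ≤ R) (hR : ∀ x, |M.reward x| ≤ R) :
    ‖N.qStar - M.qStar‖ ≤ ‖N.reward - M.reward‖ / (1 - M.discount) +
      M.discount * R * (⨆ x, ∑ s', |N.trans x s' - M.trans x s'|) / (1 - M.discount) ^ 2 := by
  have hγ0 := M.discount_mem.1
  have hγ1 : 0 < 1 - M.discount := sub_pos.2 M.discount_mem.2
  set e : ℝ := ⨆ x, ∑ s', |N.trans x s' - M.trans x s'| with he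
  have hex : ∀ x, ∑ s', |N.trans x s' - M.trans x s'| ≤ e := fun x =>
    le_ciSup (f := fun x => ∑ s', |N.trans x s' - M.trans x s'|) (Set.finite_range _).bddAbove x
  have he0 : 0 ≤ e := Real.iSup_nonneg fun x => Finset.sum_nonneg fun _ _ => abs_nonneg _
  have hq := M.norm_qStar_le hR0 hR
  -- Both fixed points are compared with `N.bellman M.qStar`: one gap contracts by `γ`, the other is
  -- the model error at the single function `M.qStar`.
  have h : ‖N.qStar - M.qStar‖ ≤ M.discount * ‖N.qStar - M.qStar‖ +
      (‖N.reward - M.reward‖ + M.discount * (e * (R / (1 - M.discount)))) := by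
    refine (pi_norm_le_iff_of_nonneg (by positivity)).2 fun x => ?_
    have h1 := N.abs_bellman_sub_qStar_le M.qStar x
    rw [hd, norm_sub_rev] at h1
    have h2 : |N.bellman M.qStar x - M.qStar x| ≤
        ‖N.reward - M.reward‖ + M.discount * (e * (R / (1 - M.discount))) := by
      have h3 : N.bellman M.qStar x - M.qStar x = (N.reward - M.reward) x +
          M.discount * ∑ s', (N.trans x s' - M.trans x s') * maxQ M.qStar s' := by
        conv_lhs => rw [← congrFun M.bellman_qStar x]
        simp only [MDP.bellman, hd, sub_mul, Finset.sum_sub_distrib,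
          Pi.sub_apply]
        ring
      rw [h3]
      refine (abs_add_le _ _).trans (add_le_add (norm_le_pi_norm (N.reward - M.reward) x) ?_)
      rw [abs_mul, abs_of_pos hγ0]
      refine mul_le_mul_of_nonneg_left ?_ hγ0.le
      calc |∑ s', (N.trans x s' - M.trans x s') * maxQ M.qStar s'|
          ≤ ∑ s', |(N.trans x s' - M.trans x s') * maxQ M.qStar s'| :=
            Finset.abs_sum_le_sum_abs _ _
        _ ≤ ∑ s', |N.trans x s' - M.trans x s'| * (R / (1 - M.discount)) := by
            refine Finset.sum_le_sum fun s' _ => ?_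
            rw [abs_mul]
            exact mul_le_mul_of_nonneg_left ((abs_maxQ_le _ _).trans hq) (abs_nonneg _)
        _ ≤ e * (R / (1 - M.discount)) := by
            rw [← Finset.sum_mul]
            exact mul_le_mul_of_nonneg_right (hex x) (by positivity)
    have h4 : (N.qStar - M.qStar) x =
        (N.bellman M.qStar x - M.qStar x) - (N.bellman M.qStar x - N.qStar x) := by
      rw [Pi.sub_apply]
      ring
    rw [Real.norm_eq_abs, h4]
    refine (abs_sub _ _).trans ?_
    linarith
  have h5 : ‖N.qStar - M.qStar‖ ≤
      (‖N.reward - M.reward‖ + M.discount * (e * (R / (1 - M.discount)))) / (1 - M.discount) := by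
    rw [le_div_iff₀ hγ1]
    linarith
  refine h5.trans_eq ?_
  field_simp

end MDPBounds

/-! ### Measurability and boundedness of the Q-learning iterates -/

/-- States, actions and draws carry no σ-algebra; their measurability is expressed by fibres, and
the composite is a finite sum over these. -/
theorem measurable_comp_of_finite {Ω Y : Type*} [Fintype Y] {m : MeasurableSpace Ω} {g : Y → Ω → ℝ}
    {f : Ω → Y} (hf : ∀ y, MeasurableSet {ω | f ω = y}) (hg : ∀ y, Measurable (g y)) :
    Measurable fun ω => g (f ω) ω := by
  classical
  have h : (fun ω => g (f ω) ω) = fun ω => ∑ y, {ω | f ω = y}.indicator (g y) ω := by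
    ext ω
    simp [Set.indicator_apply]
  rw [h]
  exact Finset.measurable_sum _ fun y _ => (hg y).indicator (hf y)

theorem measurable_maxQ {S A Ω : Type*} [Fintype A] [Nonempty A] {m : MeasurableSpace Ω}
    {Q : Ω → S × A → ℝ} (hQ : ∀ x, Measurable fun ω => Q ω x) (s : S) :
    Measurable fun ω => maxQ (Q ω) s := by
  have h := Finset.measurable_sup' (Finset.univ_nonempty (α := A))
    (f := fun a ω => Q ω (s, a)) fun a _ => hQ (s, a)
  convert h using 1
  ext ω
  simp [maxQ, Finset.sup'_apply]

namespace ChoiceModel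

variable {S A J O Z : Type*} [Fintype S] [DecidableEq S] [Fintype J] [Nonempty J]
  [Fintype O] [DecidableEq O] [Fintype Z] {d : ℕ}

/-- The sampled Bellman target `r' + γ max_{a'} Q(s',a')`. -/
def target [Fintype A] [Nonempty A] (C : ChoiceModel S A J O Z d) (γ : ℝ) (Q : S × A → ℝ)
    (x : S × A) (y : J × (O → Z)) : ℝ :=
  C.synthReward x y + γ * maxQ Q (C.synthNext x y)

/-- Summing over next states undoes the pushforward of the draw law, so target minus Bellman value
is centred noise. -/
theorem bellman_inducedMDP [Fintype A] [Nonempty A] (C : ChoiceModel S A J O Z d)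
    (θ : EuclideanSpace ℝ (Fin d)) (γ : ℝ) (hγ : γ ∈ Set.Ioo (0 : ℝ) 1) (Q : S × A → ℝ)
    (x : S × A) :
    (C.inducedMDP θ γ hγ).bellman Q x = ∑ y, C.drawProb θ x y * C.target γ Q x y := by
  have h : ∑ s', (∑ y, if C.synthNext x y = s' then C.drawProb θ x y else 0) * maxQ Q s' =
      ∑ y, C.drawProb θ x y * maxQ Q (C.synthNext x y) := by
    simp_rw [Finset.sum_mul]
    rw [Finset.sum_comm]
    simp [ite_mul]
  simp only [MDP.bellman, inducedMDP, target, h, mul_add, Finset.sum_add_distrib,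
    Finset.mul_sum]
  congr 1
  exact Finset.sum_congr rfl fun y _ => by ring

theorem drawProb_le_one (C : ChoiceModel S A J O Z d) (θ : EuclideanSpace ℝ (Fin d))
    (x : S × A) (y : J × (O → Z)) : C.drawProb θ x y ≤ 1 := by
  rw [← C.sum_drawProb θ x]
  exact Finset.single_le_sum (fun y _ => C.drawProb_nonneg θ x y) (Finset.mem_univ y)

namespace IsImputedQLearning

variable [Fintype A] [Nonempty A] [DecidableEq A] {Ω : Type*} {mΩ : MeasurableSpace Ω}
  {C : ChoiceModel S A J O Z d} {θ : EuclideanSpace ℝ (Fin d)} {γ : ℝ} {μ : Measure Ω}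
  {ℱ : Filtration ℕ mΩ} {state : ℕ → Ω → S} {action : ℕ → Ω → A} {draw : ℕ → Ω → J × (O → Z)}
  {α : ℕ → Ω → ℝ} {q₀ : S × A → ℝ} {Q : ℕ → Ω → S × A → ℝ}

theorem measurableSet_pair (hQ : C.IsImputedQLearning θ γ μ ℱ state action draw α q₀ Q) (t : ℕ)
    (x : S × A) : MeasurableSet[ℱ t] {ω | (state t ω, action t ω) = x} := by
  have h : {ω | (state t ω, action t ω) = x} = {ω | state t ω = x.1} ∩ {ω | action t ω = x.2} := by
    ext ω
    simp [Prod.ext_iff]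
  rw [h]
  exact (hQ.state_meas t x.1).inter (hQ.action_meas t x.2)

theorem measurable_table (hQ : C.IsImputedQLearning θ γ μ ℱ state action draw α q₀ Q) (t : ℕ)
    (x : S × A) : Measurable[ℱ t] fun ω => Q t ω x := by
  induction t generalizing x with
  | zero =>
    simp only [hQ.table_zero]
    exact measurable_const
  | succ t ih =>
    have hle : ℱ t ≤ ℱ (t + 1) := ℱ.mono t.le_succ
    have hQt : ∀ x, Measurable[ℱ (t + 1)] fun ω => Q t ω x := fun x => (ih x).mono hle le_rfl
    have hα : Measurable[ℱ (t + 1)] (α t) := (hQ.step_meas t).mono hle le_rfl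
    have htarget : Measurable[ℱ (t + 1)] fun ω => C.target γ (Q t ω) x (draw t ω) :=
      measurable_comp_of_finite (g := fun y ω => C.target γ (Q t ω) x y) (hQ.draw_meas t)
        fun y => ((measurable_maxQ hQt _).const_mul γ).const_add _
    have hset : MeasurableSet[ℱ (t + 1)] {ω | x = (state t ω, action t ω)} := by
      simp only [eq_comm (a := x)]
      exact hle _ (hQ.measurableSet_pair t x)
    simp only [hQ.table_succ]
    exact Measurable.ite hset (((hα.const_sub 1).mul (hQt x)).add (hα.mul htarget)) (hQt x)

theorem exists_norm_table_le (hQ : C.IsImputedQLearning θ γ μ ℱ state action draw α q₀ Q)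
    (hγ : γ ∈ Set.Ioo (0 : ℝ) 1) : ∃ B, ∀ t ω, ‖Q t ω‖ ≤ B := by
  set R : ℝ := ∑ x, ∑ y, |C.synthReward x y| with hR
  have hRxy : ∀ x y, |C.synthReward x y| ≤ R := fun x y =>
    (Finset.single_le_sum (f := fun y => |C.synthReward x y|) (fun _ _ => abs_nonneg _)
      (Finset.mem_univ y)).trans
      (Finset.single_le_sum (f := fun x => ∑ y, |C.synthReward x y|)
        (fun _ _ => Finset.sum_nonneg fun _ _ => abs_nonneg _) (Finset.mem_univ x))
  have hR0 : 0 ≤ R := Finset.sum_nonneg fun _ _ => Finset.sum_nonneg fun _ _ => abs_nonneg _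
  have hγ1 : 0 < 1 - γ := sub_pos.2 hγ.2
  have hγ0 := hγ.1
  -- This radius dominates the initial table and satisfies `R + γ * B ≤ B`, so the ball is invariant
  -- under every sampled update.
  set B : ℝ := ‖q₀‖ + R / (1 - γ) with hB
  have hB0 : 0 ≤ B := by positivity
  have hRB : R + γ * B ≤ B := by
    have h1 : R / (1 - γ) * (1 - γ) = R := div_mul_cancel₀ _ hγ1.ne'
    have h2 := mul_nonneg hγ1.le (norm_nonneg q₀)
    rw [hB]
    linarith
  refine ⟨B, fun t ω => ?_⟩
  induction t with
  | zero =>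
    rw [hQ.table_zero, hB]
    exact le_add_of_nonneg_right (by positivity)
  | succ t ih =>
    refine (pi_norm_le_iff_of_nonneg hB0).2 fun x => ?_
    have hx : |Q t ω x| ≤ B := (norm_le_pi_norm (Q t ω) x).trans ih
    rw [Real.norm_eq_abs, hQ.table_succ]
    split_ifs
    · obtain ⟨h0, h1⟩ := hQ.step_mem t ω
      have h2 : |C.synthReward x (draw t ω) + γ * maxQ (Q t ω) (C.synthNext x (draw t ω))| ≤ B := by
        refine (abs_add_le _ _).trans (le_trans (add_le_add (hRxy _ _) ?_) hRB)
        rw [abs_mul, abs_of_pos hγ0]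
        exact mul_le_mul_of_nonneg_left ((abs_maxQ_le _ _).trans ih) hγ0.le
      refine (abs_add_le _ _).trans ?_
      rw [abs_mul, abs_mul, abs_of_nonneg h0, abs_of_nonneg (sub_nonneg.2 h1)]
      calc (1 - α t ω) * |Q t ω x| + α t ω * _ ≤ (1 - α t ω) * B + α t ω * B :=
            add_le_add (mul_le_mul_of_nonneg_left hx (sub_nonneg.2 h1))
              (mul_le_mul_of_nonneg_left h2 h0)
        _ = B := by ring
    · exact hx

/-! ### Sampling noise and convergence -/

/-- The centred indicator of the draw `y` is a martingale difference. -/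
theorem condExp_draw_sub_eq_zero [IsProbabilityMeasure μ]
    (hQ : C.IsImputedQLearning θ γ μ ℱ state action draw α q₀ Q) (t : ℕ) (y : J × (O → Z)) :
    μ[fun ω => {ω | draw t ω = y}.indicator (fun _ => (1 : ℝ)) ω -
      C.drawProb θ (state t ω, action t ω) y | ℱ t] =ᵐ[μ] 0 := by
  have hp : Measurable[ℱ t] fun ω => C.drawProb θ (state t ω, action t ω) y :=
    measurable_comp_of_finite (g := fun x _ => C.drawProb θ x y) (hQ.measurableSet_pair t)
      fun x => measurable_const
  have hpi : Integrable (fun ω => C.drawProb θ (state t ω, action t ω) y) μ := by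
    refine Integrable.of_bound (hp.mono (ℱ.le t) le_rfl).aestronglyMeasurable 1
      (ae_of_all _ fun ω => ?_)
    rw [Real.norm_eq_abs, abs_of_nonneg (C.drawProb_nonneg θ _ y)]
    exact C.drawProb_le_one θ _ y
  have hi : Integrable ({ω | draw t ω = y}.indicator fun _ => (1 : ℝ)) μ :=
    (integrable_const 1).indicator (ℱ.le _ _ (hQ.draw_meas t y))
  have h1 := condExp_sub hi hpi (ℱ t)
  rw [condExp_of_stronglyMeasurable (ℱ.le t) hp.stronglyMeasurable hpi] at h1
  filter_upwards [h1, hQ.draw_law t y] with ω h1 h2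
  refine h1.trans ?_
  simp [h2]

/-- The sampling noise, weighted by the step sizes along the visits to `x`, has almost surely
convergent partial sums. -/
theorem ae_tendsto_sum_noise [IsProbabilityMeasure μ]
    (hQ : C.IsImputedQLearning θ γ μ ℱ state action draw α q₀ Q) (hγ : γ ∈ Set.Ioo (0 : ℝ) 1)
    (hcov : RobbinsMonroCoverage μ state action α) (x : S × A) :
    ∀ᵐ ω ∂μ, ∃ l, Tendsto (fun n => ∑ t ∈ Finset.range n,
      (if (state t ω, action t ω) = x then α t ω else 0) *
        (C.target γ (Q t ω) x (draw t ω) - (C.inducedMDP θ γ hγ).bellman (Q t ω) x))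
      atTop (𝓝 l) := by
  classical
  obtain ⟨B, hB⟩ := hQ.exists_norm_table_le hγ
  -- There are finitely many draws, so the noise splits as a sum over `y` of the target at `y`,
  -- which is predictable, times the centred indicator of `y`, which is a bounded martingale
  -- difference.
  set D : J × (O → Z) → ℕ → Ω → ℝ := fun y t ω =>
    {ω | draw t ω = y}.indicator (fun _ => (1 : ℝ)) ω - C.drawProb θ (state t ω, action t ω) y
    with hD
  set H : J × (O → Z) → ℕ → Ω → ℝ := fun y t ω =>
    (if (state t ω, action t ω) = x then α t ω else 0) * C.target γ (Q t ω) x y with hH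
  have hconv : ∀ y, ∀ᵐ ω ∂μ, ∃ l,
      Tendsto (fun n => ∑ t ∈ Finset.range n, H y t ω * D y t ω) atTop (𝓝 l) := by
    intro y
    refine ae_tendsto_martingaleTransform (ℱ := ℱ) (fun t => ?_) (fun t ω => ?_)
      (fun t => hQ.condExp_draw_sub_eq_zero t y) (fun t => ?_) ?_
    · have hp : Measurable[ℱ t] fun ω => C.drawProb θ (state t ω, action t ω) y :=
        measurable_comp_of_finite (g := fun x _ => C.drawProb θ x y) (hQ.measurableSet_pair t)
          fun x => measurable_const
      exact (measurable_const.indicator (hQ.draw_meas t y)).sub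
        (hp.mono (ℱ.mono t.le_succ) le_rfl)
    · have h0 := C.drawProb_nonneg θ (state t ω, action t ω) y
      have h1 := C.drawProb_le_one θ (state t ω, action t ω) y
      simp only [hD, Set.indicator_apply]
      rw [abs_le]
      split_ifs <;> constructor <;> linarith
    · exact (Measurable.ite (hQ.measurableSet_pair t x) (hQ.step_meas t) measurable_const).mul
        (((measurable_maxQ (hQ.measurable_table t) _).const_mul γ).const_add _)
    · filter_upwards [hcov] with ω hω
      set c : ℝ := |C.synthReward x y| + γ * B with hc
      refine Summable.of_nonneg_of_le (fun t => sq_nonneg _) (fun t => ?_)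
        ((hω x).2.mul_right (c ^ 2))
      have htc : |C.target γ (Q t ω) x y| ≤ c := by
        refine (abs_add_le _ _).trans (add_le_add le_rfl ?_)
        rw [abs_mul, abs_of_pos hγ.1]
        exact mul_le_mul_of_nonneg_left ((abs_maxQ_le _ _).trans (hB t ω)) hγ.1.le
      have hsq : C.target γ (Q t ω) x y ^ 2 ≤ c ^ 2 := by
        rw [← sq_abs]
        exact pow_le_pow_left₀ (abs_nonneg _) htc 2
      simp only [hH, mul_pow]
      split_ifs
      · exact mul_le_mul_of_nonneg_left hsq (sq_nonneg _)
      · simp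
  filter_upwards [ae_all_iff.2 hconv] with ω hω
  choose l hl using hω
  refine ⟨∑ y, l y, (tendsto_finsetSum _ fun y _ => hl y).congr fun n => ?_⟩
  rw [Finset.sum_comm]
  refine Finset.sum_congr rfl fun t _ => ?_
  rw [C.bellman_inducedMDP]
  simp only [hH, hD]
  -- On a visit the draw law at the current pair is the law at `x`; off visits the weight is zero.
  split_ifs with h
  · rw [h]
    simp only [mul_sub, mul_assoc, Finset.sum_sub_distrib, ← Finset.mul_sum]
    congr 1
    · simp [Set.indicator_apply]
    · congr 1
      exact Finset.sum_congr rfl fun y _ => mul_comm _ _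
  · simp

/-- Giving unvisited pairs step size zero makes the asynchronous update one recursion valid at every
coordinate. -/
theorem ae_tendsto_norm_sub_qStar [IsProbabilityMeasure μ]
    (hQ : C.IsImputedQLearning θ γ μ ℱ state action draw α q₀ Q) (hγ : γ ∈ Set.Ioo (0 : ℝ) 1)
    (hcov : RobbinsMonroCoverage μ state action α) :
    ∀ᵐ ω ∂μ, Tendsto (fun t => ‖Q t ω - (C.inducedMDP θ γ hγ).qStar‖) atTop (𝓝 0) := by
  obtain ⟨B, hB⟩ := hQ.exists_norm_table_le hγ
  filter_upwards [hcov, ae_all_iff.2 (hQ.ae_tendsto_sum_noise hγ hcov)] with ω h1 h2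
  refine tendsto_norm_sub_of_async_contraction hγ.1.le hγ.2
    (C.inducedMDP θ γ hγ).abs_bellman_sub_qStar_le (fun t x => ?_) (fun x => (h1 x).1) h2
    (fun t x => ?_) (fun t => hB t ω)
  · split_ifs
    · exact hQ.step_mem t ω
    · simp
  · rw [hQ.table_succ]
    by_cases h : (state t ω, action t ω) = x
    · rw [if_pos h.symm, if_pos h, target]
      ring
    · rw [if_neg (Ne.symm h), if_neg h]
      ring

end IsImputedQLearning

end ChoiceModel

theorem mainTheorem3 {S A J O Z Ω : Type*} [Fintype S] [DecidableEq S]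
    [Fintype A] [Nonempty A] [DecidableEq A] [Fintype J] [Nonempty J]
    [Fintype O] [DecidableEq O] [Fintype Z] {d : ℕ}
    {mΩ : MeasurableSpace Ω} (μ : Measure Ω) [IsProbabilityMeasure μ] (ℱ : Filtration ℕ mΩ)
    -- the true MDP, with bounded rewards
    (M : MDP S A) (Rmax : ℝ) (hR : ∀ x, |M.reward x| ≤ Rmax)
    -- the fixed choice model and the approximate MDP that it induces
    (C : ChoiceModel S A J O Z d) (θ : EuclideanSpace ℝ (Fin d))
    (Mθ : MDP S A) (hMθ : Mθ = C.inducedMDP θ M.discount M.discount_mem)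
    -- tabular Q-learning driven by samples of the approximate MDP
    (state : ℕ → Ω → S) (action : ℕ → Ω → A) (draw : ℕ → Ω → J × (O → Z))
    (α : ℕ → Ω → ℝ) (q₀ : S × A → ℝ) (Q : ℕ → Ω → S × A → ℝ)
    (hQ : C.IsImputedQLearning θ M.discount μ ℱ state action draw α q₀ Q)
    (hcov : RobbinsMonroCoverage μ state action α)
    -- the reward and transition approximation errors
    (εr εP : ℝ) (hεr : εr = ‖Mθ.reward - M.reward‖)
    (hεP : εP = ⨆ x, ∑ s', |Mθ.trans x s' - M.trans x s'|) :
    ∀ᵐ ω ∂μ,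
      Tendsto (fun t => ‖Q t ω - Mθ.qStar‖) atTop (𝓝 0) ∧
      Tendsto (fun t => ‖Q t ω - M.qStar‖) atTop (𝓝 ‖Mθ.qStar - M.qStar‖) ∧
      limsup (fun t => ‖Q t ω - M.qStar‖) atTop ≤
        εr / (1 - M.discount) + M.discount * Rmax * εP / (1 - M.discount) ^ 2 := by
  subst hMθ
  filter_upwards [hQ.ae_tendsto_norm_sub_qStar M.discount_mem hcov] with ω hω
  have hlim : Tendsto (fun t => ‖Q t ω - M.qStar‖) atTop
      (𝓝 ‖(C.inducedMDP θ M.discount M.discount_mem).qStar - M.qStar‖) :=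
    ((tendsto_iff_norm_sub_tendsto_zero.2 hω).sub_const _).norm
  refine ⟨hω, hlim, ?_⟩
  -- `S` is not assumed nonempty; the sample path supplies a pair.
  have hR0 : 0 ≤ Rmax := (abs_nonneg _).trans (hR (state 0 ω, action 0 ω))
  rw [hlim.limsup_eq, hεr, hεP]
  exact M.norm_qStar_sub_qStar_le (C.inducedMDP θ M.discount M.discount_mem) rfl hR0 hR
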